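/- Let $\mathcal F$ be a family of finite point sets in $\mathbb R^d$. For $\varepsilon>0$, an $\varepsilon$-net of a finite set $P\subset\mathbb R^d$ is a subset $N\subseteq P$ such that every point of $P$ is within distance $\varepsilon$ of a point of $N$ and any two distinct points of $N$ are at distance at least $\varepsilon$. For real $\delta\ge 0$ and $K$, say that $\mathcal F$ satisfies the net bound with exponent $\delta$ and constant $K$ if $|N\cap B(x,r)|\le K(r/\varepsilon)^{\delta}$ for all $P\in\mathcal F$, all $\varepsilon>0$ and $r\ge 2\varepsilon$, all $\varepsilon$-nets $N$ of $P$ and all closed balls $B(x,r)$, $x\in\mathbb R^d$. The fractal dimension $\dim_{\mathsf f}(\mathcal F)$ is the infimum of the $\delta\ge 0$ for which $\mathcal F$ satisfies the net bound with exponent $\delta$ and some constant $K$. **Theorem.** There is an absolute constant $c>0$ such that the following holds for every integer $d\ge 2$ and every real $\delta\in(0,d]$. Let $\mathcal F$ be a family of finite point sets in $\mathbb R^d$ with $\dim_{\mathsf f}(\mathcal F)=\delta$; if $\delta\ge1$, suppose that the infimum is attained, that is, that $\mathcal F$ satisfies the net bound with exponent $\delta$ and some constant. Then for every $P\in\mathcal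 F$ with $n=|P|\ge 2$ and for the edge set $W$ of any optimal (shortest closed) Euclidean TSP tour of $P$, the edges being closed line segments, there is a $(d-1)$-sphere $C$ of positive radius such that at most $(1-2^{-cd})n$ points of $P$ lie strictly inside $C$, at most $(1-2^{-cd})n$ points of $P$ lie strictly outside $C$, and $$|\{w\in W: w\cap C\neq\emptyset\}|=\begin{cases}O(n^{1-1/\delta}) & \text{if }\delta>1,\\ O(\log n)&\text{if }\delta=1,\\ O\left(\dfrac{1}{2^{1-\delta}-1}\right)&\text{if }\delta<1,\end{cases}$$ where the hidden constant does not depend on $P$ or on the tour. Moreover, for every family that satisfies the net bound with exponent $\delta\in(0,d]$ and constant $K$ (so that its fractal dimension is at most $\delta$), the same conclusion holds, with the same $c$, with a hidden constant that depends only on $d$ and $K$ if $\delta\le 1$, and only on $d$, $K$ and $\delta$ if $\delta>1$. -/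

import Mathlib

/-- Euclidean `d`-space. -/
abbrev Euc (d : ℕ) : Type := EuclideanSpace ℝ (Fin d)

/-- `N` is an `ε`-net of the finite set `P`: a subset of `P` that is an `ε`-covering and an
`ε`-packing of `P`. -/
def IsEpsNet {d : ℕ} (ε : ℝ) (N P : Finset (Euc d)) : Prop :=
  N ⊆ P ∧ (∀ x ∈ P, ∃ y ∈ N, dist x y ≤ ε) ∧ (∀ x ∈ N, ∀ y ∈ N, x ≠ y → ε ≤ dist x y)

/-- Every `ε`-net of every member of the family `F` has at most `K * (r / ε) ^ δ` points in any
closed ball of radius `r ≥ 2 * ε`. -/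
def NetBound {d : ℕ} (F : Set (Finset (Euc d))) (δ K : ℝ) : Prop :=
  ∀ P ∈ F, ∀ ε r : ℝ, 0 < ε → 2 * ε ≤ r → ∀ N : Finset (Euc d), IsEpsNet ε N P →
    ∀ x : Euc d, (((N : Set (Euc d)) ∩ Metric.closedBall x r).ncard : ℝ) ≤ K * (r / ε) ^ δ

/-- The exponents `δ` for which the number of net points in balls is `O((r / ε) ^ δ)`, uniformly
over the family. -/
def fractalExponents {d : ℕ} (F : Set (Finset (Euc d))) : Set ℝ :=
  {δ | 0 ≤ δ ∧ ∃ K : ℝ, NetBound F δ K}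

/-- The fractal dimension of a family of finite point sets. -/
noncomputable def fractalDim {d : ℕ} (F : Set (Finset (Euc d))) : ℝ :=
  sInf (fractalExponents F)

/-- A closed tour through `P`, given as a cyclic enumeration of its points. -/
abbrev Tour {d : ℕ} (P : Finset (Euc d)) : Type := Fin P.card ≃ P

/-- The Euclidean length of a tour (`finRotate` is `i ↦ i + 1` modulo the number of points). -/
noncomputable def tourLength {d : ℕ} {P : Finset (Euc d)} (e : Tour P) : ℝ :=
  ∑ i, dist (e i : Euc d) (e (finRotate P.card i) : Euc d)

/-- The tour has minimum length among all tours of `P`. -/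
def IsOptimalTour {d : ℕ} {P : Finset (Euc d)} (e : Tour P) : Prop :=
  ∀ e' : Tour P, tourLength e ≤ tourLength e'

/-- The set of edges of a tour, each edge being a closed line segment. -/
def tourEdges {d : ℕ} {P : Finset (Euc d)} (e : Tour P) : Set (Set (Euc d)) :=
  Set.range fun i => segment ℝ (e i : Euc d) (e (finRotate P.card i) : Euc d)

/-- There is a sphere with at most a `1 - 2 ^ (-(c * d))` fraction of the points of `P` strictly
inside, at most that fraction strictly outside, and that meets at most `M` members of `W`. -/
def HasSphereSeparator {d : ℕ} (c : ℝ) (P : Finset (Euc d)) (W : Set (Set (Euc d))) (M : ℝ) :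
    Prop :=
  ∃ (o : Euc d) (r : ℝ), 0 < r ∧
    (((P : Set (Euc d)) ∩ Metric.ball o r).ncard : ℝ)
      ≤ (1 - (2 : ℝ) ^ (-(c * (d : ℝ)))) * (P.card : ℝ) ∧
    (((P : Set (Euc d)) \ Metric.closedBall o r).ncard : ℝ)
      ≤ (1 - (2 : ℝ) ^ (-(c * (d : ℝ)))) * (P.card : ℝ) ∧
    (({w ∈ W | (w ∩ Metric.sphere o r).Nonempty}).ncard : ℝ) ≤ M

/-- The three growth rates of the number of crossing edges. -/
noncomputable def crossingRate (δ : ℝ) (n : ℕ) : ℝ :=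
  if 1 < δ then (n : ℝ) ^ (1 - 1 / δ)
  else if δ = 1 then Real.log n
  else 1 / ((2 : ℝ) ^ (1 - δ) - 1)

/-! Take a nearly smallest-possible dense ball: among closed balls centred in `P` holding `m`, about
n / (2 * 5^d), points, one of minimal radius r. The ball of radius 2 * r is covered by 5^d open
balls of radius r centred in `P`, each with fewer than `m` points, so every concentric sphere of
radius ρ in [r, 2 * r] is balanced (`exists_minimal_ball`, `card_filter_dist_le_two_mul`). It
remains to choose ρ.

Optimality enters only through two-opt exchanges: edges of length at least L containing points
within L / 4 of each other must have well separated directions, so there are at most 2 * 5^d of them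
(`IsOptimalTour.card_le_of_close`). Hence boundedly many edges of length at least 32 * r reach the
ball of radius 2 * r. Shorter edges that can cross start within 34 * r of the centre. Those of
length about r / 2^k are charged to points of an (r / 2^k)-net, each charged boundedly often, so
there are O(2^(k * δ)) of them.

A short edge is crossed only for ρ in an interval of twice its length. Averaging over ρ thus gives
O(total short length / r) crossings. Summing T scales and bounding the at most n remaining edges
trivially gives the sum of 2^(k * (δ - 1)) over k < T, plus n / 2^T. A suitable T yields the three
rates. -/

/-! ### Two-opt exchanges in optimal tours -/

theorem coe_finRotate_eq {n : ℕ} (k : Fin n) :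
    (finRotate n k : ℕ) = if (k : ℕ) + 1 < n then (k : ℕ) + 1 else 0 := by
  cases n with
  | zero => exact k.elim0
  | succ m =>
    rw [coe_finRotate]
    have := k.isLt
    simp only [Fin.ext_iff, Fin.val_last]
    split_ifs <;> omega

/-- The permutation of `Fin n` that reverses the interval of indices `k` with `i ≤ k ≤ j`. -/
def reverseInterval {n : ℕ} (i : ℕ) (j : Fin n) : Equiv.Perm (Fin n) :=
  Function.Involutive.toPerm
    (fun k => if h : i ≤ k ∧ (k : ℕ) ≤ j then ⟨i + j - k, by omega⟩ else k) (by
      intro k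
      by_cases h : i ≤ k ∧ (k : ℕ) ≤ j
      · have h' : i ≤ i + (j : ℕ) - k ∧ i + (j : ℕ) - k ≤ j := by omega
        simp only [h, and_self, dite_true, h']
        ext
        simp only
        omega
      · simp only [h, dite_false])

theorem coe_reverseInterval {n : ℕ} (i : ℕ) (j k : Fin n) :
    (reverseInterval i j k : ℕ) = if i ≤ k ∧ (k : ℕ) ≤ j then i + j - k else k := by
  change ((if h : i ≤ k ∧ (k : ℕ) ≤ j then ⟨i + j - k, by omega⟩ else k : Fin n) : ℕ) = _
  split_ifs <;> rfl

/-- Reversing a stretch of a closed tour exchanges two edges. -/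
theorem sum_dist_reverseInterval {n : ℕ} {X : Type*} [PseudoMetricSpace X] (f : Fin n → X)
    {i j : Fin n} (hij : i < j) :
    ∑ k, dist (f (reverseInterval (i + 1) j k)) (f (reverseInterval (i + 1) j (finRotate n k)))
      + (dist (f i) (f (finRotate n i)) + dist (f j) (f (finRotate n j))) =
    ∑ k, dist (f k) (f (finRotate n k))
      + (dist (f i) (f j) + dist (f (finRotate n i)) (f (finRotate n j))) := by
  have hlt : (i : ℕ) < j := hij
  have hj := j.isLt
  have hne : j ∈ Finset.univ.erase i := by simp [hij.ne']
  rw [← Finset.add_sum_erase _ _ (Finset.mem_univ i), ← Finset.add_sum_erase _ _ hne,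
    ← Finset.add_sum_erase (Finset.univ : Finset (Fin n)) (fun k => dist (f k) _)
      (Finset.mem_univ i), ← Finset.add_sum_erase _ (fun k => dist (f k) _) hne]
  have e1 : reverseInterval (i + 1) j i = i := by
    ext; rw [coe_reverseInterval]; split_ifs <;> omega
  have e2 : reverseInterval (i + 1) j (finRotate n i) = j := by
    ext; rw [coe_reverseInterval, coe_finRotate_eq]; split_ifs <;> omega
  have e3 : reverseInterval (i + 1) j j = finRotate n i := by
    ext; rw [coe_reverseInterval, coe_finRotate_eq]; split_ifs <;> omega
  -- If `j` is the last index, its successor wraps to 0, which still lies below the reversed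
  -- interval.
  have e4 : reverseInterval (i + 1) j (finRotate n j) = finRotate n j := by
    ext; rw [coe_reverseInterval, coe_finRotate_eq]; split_ifs <;> omega
  have key : ∑ k ∈ (Finset.univ.erase i).erase j,
      dist (f (reverseInterval (i + 1) j k)) (f (reverseInterval (i + 1) j (finRotate n k))) =
      ∑ k ∈ (Finset.univ.erase i).erase j, dist (f k) (f (finRotate n k)) := by
    have hmem : ∀ k ∈ (Finset.univ.erase i).erase j, (k : ℕ) ≠ i ∧ (k : ℕ) ≠ j := by
      intro k hk
      simp only [Finset.mem_erase, Finset.mem_univ, and_true, ne_eq, Fin.ext_iff] at hk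
      exact ⟨hk.2, hk.1⟩
    -- the edge at position `k` inside the stretch becomes the edge at position `i + j - k`
    have hinv : ∀ k ∈ (Finset.univ.erase i).erase j,
        (reverseInterval (i : ℕ) j) k ∈ (Finset.univ.erase i).erase j := by
      intro k hk
      have := hmem k hk
      simp only [Finset.mem_erase, Finset.mem_univ, and_true, ne_eq, Fin.ext_iff,
        coe_reverseInterval]
      split_ifs <;> omega
    have hself : ∀ k, reverseInterval (i : ℕ) j (reverseInterval (i : ℕ) j k) = k := by
      intro k
      ext
      simp only [coe_reverseInterval]
      split_ifs <;> omega
    refine Finset.sum_bij' (fun k _ => reverseInterval (i : ℕ) j k)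
      (fun k _ => reverseInterval (i : ℕ) j k) hinv hinv (fun k _ => hself k)
      (fun k _ => hself k) ?_
    intro k hk
    have hk' := hmem k hk
    have hkn := k.isLt
    by_cases h : (i : ℕ) ≤ k ∧ (k : ℕ) ≤ j
    · have a1 : reverseInterval (i + 1) j k = finRotate n (reverseInterval (i : ℕ) j k) := by
        ext; rw [coe_finRotate_eq, coe_reverseInterval, coe_reverseInterval]
        split_ifs <;> omega
      have a2 : reverseInterval (i + 1) j (finRotate n k) = reverseInterval (i : ℕ) j k := by
        ext; rw [coe_reverseInterval, coe_reverseInterval, coe_finRotate_eq]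
        split_ifs <;> omega
      rw [a1, a2, dist_comm]
    · have a0 : reverseInterval (i : ℕ) j k = k := by
        ext; rw [coe_reverseInterval]; split_ifs; rfl
      have a1 : reverseInterval (i + 1) j k = k := by
        ext; rw [coe_reverseInterval]; split_ifs <;> omega
      have a2 : reverseInterval (i + 1) j (finRotate n k) = finRotate n k := by
        ext; rw [coe_reverseInterval, coe_finRotate_eq]; split_ifs <;> omega
      rw [a0, a1, a2]
  rw [e1, e2, e3, e4, key]
  ring

/-- An optimal tour is not shortened by exchanging two of its edges. -/
theorem IsOptimalTour.two_opt {d : ℕ} {P : Finset (Euc d)} {e : Tour P} (he : IsOptimalTour e)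
    {i j : Fin P.card} (hij : i ≠ j) :
    dist (e i : Euc d) (e (finRotate P.card i)) + dist (e j : Euc d) (e (finRotate P.card j)) ≤
      dist (e i : Euc d) (e j) + dist (e (finRotate P.card i) : Euc d) (e (finRotate P.card j)) := by
  wlog h : i < j generalizing i j
  · have := this hij.symm (lt_of_le_of_ne (not_lt.1 h) hij.symm)
    rw [dist_comm (e i : Euc d) (e j), dist_comm (e (finRotate P.card i) : Euc d)]
    linarith
  have h1 := he ((reverseInterval (i + 1) j).trans e)
  have h2 := sum_dist_reverseInterval (fun k => (e k : Euc d)) h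
  simp only [tourLength, Equiv.trans_apply] at h1
  linarith

/-! ### Packing of long edges -/

/-- If two segments of length at least `L` contain points at distance less than `L / 4`, have
directions at distance at most `1`, and both extend by at least `L / 2` on the same side, then
they can be exchanged with profit. -/
theorem exchange_lt {E : Type*} [NormedAddCommGroup E] [NormedSpace ℝ E]
    {p p' u u' : E} {s t s' t' L : ℝ} (hu : ‖u‖ = 1) (hu' : ‖u'‖ = 1)
    (hs : 0 ≤ s) (ht : 0 ≤ t) (hs' : 0 ≤ s') (ht' : 0 ≤ t')
    (hL : L / 2 ≤ min s s' + min t t') (hp : ‖p - p'‖ < L / 4) (huu : ‖u - u'‖ ≤ 1) :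
    ‖(p - s • u) - (p' - s' • u')‖ + ‖(p + t • u) - (p' + t' • u')‖ < (s + t) + (s' + t') := by
  -- Along the common length min x y the two rays drift apart by at most min x y, instead of 2 * min
  -- x y. Over both sides this saves at least L / 2, more than the 2 * ‖p - p'‖ that the exchange
  -- costs.
  have aux : ∀ x y : ℝ, 0 ≤ x → 0 ≤ y →
      ‖x • u - y • u'‖ ≤ x + y - min x y := by
    intro x y hx hy
    rcases le_total x y with h | h
    · have : x • u - y • u' = x • (u - u') - (y - x) • u' := by module
      rw [this, min_eq_left h]
      refine (norm_sub_le _ _).trans ?_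
      rw [norm_smul, norm_smul, hu', Real.norm_of_nonneg hx, Real.norm_of_nonneg (sub_nonneg.2 h)]
      nlinarith
    · have : x • u - y • u' = y • (u - u') + (x - y) • u := by module
      rw [this, min_eq_right h]
      refine (norm_add_le _ _).trans ?_
      rw [norm_smul, norm_smul, hu, Real.norm_of_nonneg hy, Real.norm_of_nonneg (sub_nonneg.2 h)]
      nlinarith
  have h1 : ‖(p - s • u) - (p' - s' • u')‖ ≤ ‖p - p'‖ + (s + s' - min s s') := by
    have : (p - s • u) - (p' - s' • u') = (p - p') - (s • u - s' • u') := by module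
    rw [this]
    exact (norm_sub_le _ _).trans (by gcongr; exact aux s s' hs hs')
  have h2 : ‖(p + t • u) - (p' + t' • u')‖ ≤ ‖p - p'‖ + (t + t' - min t t') := by
    have : (p + t • u) - (p' + t' • u') = (p - p') + (t • u - t' • u') := by module
    rw [this]
    exact (norm_add_le _ _).trans (by gcongr; exact aux t t' ht ht')
  linarith

/-- A family of unit vectors at pairwise distances greater than `1` has at most `5 ^ d` members. -/
theorem card_le_of_unit_separated {d : ℕ} {ι : Type*} (J : Finset ι) (u : ι → Euc d)
    (hu : ∀ i ∈ J, ‖u i‖ = 1) (hsep : ∀ i ∈ J, ∀ j ∈ J, i ≠ j → 1 < ‖u i - u j‖) :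
    J.card ≤ 5 ^ d := by
  classical
  have hinj : Set.InjOn u J := by
    intro i hi j hj h
    by_contra hne
    have := hsep i hi j hj hne
    rw [h, sub_self, norm_zero] at this
    linarith
  rw [← Finset.card_image_of_injOn hinj]
  -- This bound allows norms up to 2; the volume comparison is between disjoint balls of radius 1/2
  -- and a ball of radius 5/2.
  have := Besicovitch.card_le_of_separated (J.image u)
    (by
      intro c hc
      obtain ⟨i, hi, rfl⟩ := Finset.mem_image.1 hc
      rw [hu i hi]; norm_num)
    (by
      intro c hc c' hc' hne
      obtain ⟨i, hi, rfl⟩ := Finset.mem_image.1 hc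
      obtain ⟨j, hj, rfl⟩ := Finset.mem_image.1 hc'
      exact (hsep i hi j hj (fun h => hne (h ▸ rfl))).le)
  rwa [finrank_euclideanSpace, Fintype.card_fin] at this

/-- A point of a nondegenerate segment splits it into two parts along a unit direction. -/
theorem exists_direction_of_mem_segment {E : Type*} [NormedAddCommGroup E] [NormedSpace ℝ E]
    {a b p : E} (hab : 0 < dist a b) (hp : p ∈ segment ℝ a b) :
    ∃ (u : E) (s t : ℝ), ‖u‖ = 1 ∧ 0 ≤ s ∧ 0 ≤ t ∧ s + t = dist a b ∧
      a = p - s • u ∧ b = p + t • u := by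
  obtain ⟨x, y, hx, hy, hxy, rfl⟩ := hp
  have hne := hab.ne'
  refine ⟨(dist a b)⁻¹ • (b - a), y * dist a b, x * dist a b, ?_, by positivity, by positivity,
    ?_, ?_, ?_⟩
  · rw [norm_smul, norm_inv, Real.norm_of_nonneg dist_nonneg, dist_comm a b, dist_eq_norm,
      inv_mul_cancel₀]
    rwa [← dist_eq_norm, dist_comm]
  · rw [← add_mul, add_comm y x, hxy, one_mul]
  · rw [smul_smul, mul_assoc, mul_inv_cancel₀ hne, mul_one]
    obtain rfl : x = 1 - y := by linarith
    module
  · rw [smul_smul, mul_assoc, mul_inv_cancel₀ hne, mul_one]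
    obtain rfl : x = 1 - y := by linarith
    module

/-- Packing property of optimal tours: few long edges come close to one another. -/
theorem IsOptimalTour.card_le_of_close {d : ℕ} {P : Finset (Euc d)} {e : Tour P}
    (he : IsOptimalTour e) {L : ℝ} (hL : 0 < L) (J : Finset (Fin P.card)) (p : Fin P.card → Euc d)
    (hlen : ∀ i ∈ J, L ≤ dist (e i : Euc d) (e (finRotate P.card i)))
    (hp : ∀ i ∈ J, p i ∈ segment ℝ (e i : Euc d) (e (finRotate P.card i)))
    (hclose : ∀ i ∈ J, ∀ j ∈ J, dist (p i) (p j) < L / 4) :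
    J.card ≤ 2 * 5 ^ d := by
  classical
  have hdata : ∀ i, ∃ (u : Euc d) (s t : ℝ), i ∈ J → ‖u‖ = 1 ∧ 0 ≤ s ∧ 0 ≤ t ∧
      s + t = dist (e i : Euc d) (e (finRotate P.card i)) ∧
      (e i : Euc d) = p i - s • u ∧ (e (finRotate P.card i) : Euc d) = p i + t • u := by
    intro i
    by_cases hi : i ∈ J
    · obtain ⟨u, s, t, h⟩ := exists_direction_of_mem_segment (hL.trans_le (hlen i hi)) (hp i hi)
      exact ⟨u, s, t, fun _ => h⟩
    · exact ⟨0, 0, 0, fun h => absurd h hi⟩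
  choose u s t h using hdata
  have hsep : ∀ i ∈ J, ∀ j ∈ J, i ≠ j → L / 2 ≤ min (s i) (s j) + min (t i) (t j) →
      1 < ‖u i - u j‖ := by
    intro i hi j hj hij hmin
    by_contra! hle
    obtain ⟨hu, hs, ht, hst, ha, hb⟩ := h i hi
    obtain ⟨hu', hs', ht', hst', ha', hb'⟩ := h j hj
    have h1 := exchange_lt hu hu' hs ht hs' ht' hmin
      (by rw [← dist_eq_norm]; exact hclose i hi j hj) hle
    have h2 := he.two_opt hij
    rw [← ha, ← ha', ← hb, ← hb', ← dist_eq_norm, ← dist_eq_norm, hst, hst'] at h1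
    linarith
  -- Each marked point leaves at least L / 2 of its edge on one side. Edges sharing that side
  -- satisfy the exchange condition pairwise, whence the factor 2.
  have h1 : (J.filter fun i => L / 2 ≤ s i).card ≤ 5 ^ d := by
    refine card_le_of_unit_separated _ u (fun i hi => (h i (Finset.mem_filter.1 hi).1).1) ?_
    intro i hi j hj hij
    rw [Finset.mem_filter] at hi hj
    refine hsep i hi.1 j hj.1 hij ?_
    have := le_min hi.2 hj.2
    have := le_min (h i hi.1).2.2.1 (h j hj.1).2.2.1
    linarith
  have h2 : (J.filter fun i => ¬ L / 2 ≤ s i).card ≤ 5 ^ d := by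
    refine card_le_of_unit_separated _ u (fun i hi => (h i (Finset.mem_filter.1 hi).1).1) ?_
    intro i hi j hj hij
    rw [Finset.mem_filter] at hi hj
    refine hsep i hi.1 j hj.1 hij ?_
    have hti : L / 2 ≤ t i := by linarith [hlen i hi.1, (h i hi.1).2.2.2.1]
    have htj : L / 2 ≤ t j := by linarith [hlen j hj.1, (h j hj.1).2.2.2.1]
    have := le_min hti htj
    have := le_min (h i hi.1).2.1 (h j hj.1).2.1
    linarith
  rw [← Finset.card_filter_add_card_filter_not (s := J) (fun i => L / 2 ≤ s i)]
  omega

/-! ### Nets, averaging and dyadic sums -/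

/-- Every finite subset contains a maximal separated subset. -/
theorem exists_maximal_separated {X : Type*} [PseudoMetricSpace X] (Q : Finset X) {ε : ℝ}
    (hε : 0 < ε) :
    ∃ N ⊆ Q, (∀ x ∈ Q, ∃ y ∈ N, dist x y < ε) ∧
      ∀ x ∈ N, ∀ y ∈ N, x ≠ y → ε ≤ dist x y := by
  classical
  induction Q using Finset.induction_on with
  | empty => exact ⟨∅, by simp⟩
  | insert a Q _ ih =>
    obtain ⟨N, hNQ, hcov, hsep⟩ := ih
    by_cases h : ∃ y ∈ N, dist a y < ε
    · refine ⟨N, hNQ.trans (Finset.subset_insert _ _), ?_, hsep⟩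
      intro x hx
      rcases Finset.mem_insert.1 hx with rfl | hx
      exacts [h, hcov x hx]
    · push Not at h
      refine ⟨insert a N, Finset.insert_subset_insert _ hNQ, ?_, ?_⟩
      · intro x hx
        rcases Finset.mem_insert.1 hx with rfl | hx
        · exact ⟨x, Finset.mem_insert_self _ _, by simpa using hε⟩
        · obtain ⟨y, hy, hxy⟩ := hcov x hx
          exact ⟨y, Finset.mem_insert_of_mem hy, hxy⟩
      · intro x hx y hy hxy
        rcases Finset.mem_insert.1 hx with hxa | hxN <;>
          rcases Finset.mem_insert.1 hy with hya | hyN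
        · exact absurd (hxa.trans hya.symm) hxy
        · exact hxa ▸ h y hyN
        · rw [dist_comm]; exact hya ▸ h x hxN
        · exact hsep x hxN y hyN hxy

theorem exists_isEpsNet {d : ℕ} (P : Finset (Euc d)) {ε : ℝ} (hε : 0 < ε) :
    ∃ N, IsEpsNet ε N P := by
  obtain ⟨N, hN, hcov, hsep⟩ := exists_maximal_separated P hε
  exact ⟨N, hN, fun x hx => (hcov x hx).imp fun y hy => ⟨hy.1, hy.2.le⟩, hsep⟩

open MeasureTheory in
/-- Averaging: some `ρ ∈ [r, 2 * r]` is covered by few of the given intervals. -/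
theorem exists_card_filter_abs_sub_le {ι : Type*} (G : Finset ι) (c l : ι → ℝ)
    (hl : ∀ i ∈ G, 0 ≤ l i) {r : ℝ} (hr : 0 < r) :
    ∃ ρ ∈ Set.Icc r (2 * r),
      ((G.filter fun i => |ρ - c i| ≤ l i).card : ℝ) ≤ 2 * (∑ i ∈ G, l i) / r := by
  -- f counts the intervals containing ρ, and its integral is at most the sum of their lengths 2 * l
  -- i.
  set f : ℝ → ℝ := fun ρ => ∑ i ∈ G, (Set.Icc (c i - l i) (c i + l i)).indicator 1 ρ with hf
  have hint : ∀ i ∈ G, IntegrableOn ((Set.Icc (c i - l i) (c i + l i)).indicator (1 : ℝ → ℝ))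
      (Set.Icc r (2 * r)) := by
    intro i _
    refine Integrable.indicator ?_ measurableSet_Icc
    exact integrableOn_const (by simp)
  obtain ⟨ρ, hρ, h⟩ := exists_le_setAverage (μ := volume) (s := Set.Icc r (2 * r)) (f := f)
    (by simp [Real.volume_Icc]; linarith) (by simp) (integrable_finsetSum _ hint)
  refine ⟨ρ, hρ, ?_⟩
  have hcard : ((G.filter fun i => |ρ - c i| ≤ l i).card : ℝ) = f ρ := by
    rw [hf, Finset.card_filter]
    push_cast
    refine Finset.sum_congr rfl fun i _ => ?_
    rw [Set.indicator_apply]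
    refine if_congr ?_ rfl rfl
    rw [abs_le, Set.mem_Icc]
    constructor <;> rintro ⟨h1, h2⟩ <;> constructor <;> linarith
  rw [hcard]
  refine h.trans ?_
  rw [setAverage_eq, hf, integral_finsetSum _ hint, smul_eq_mul, Measure.real, Real.volume_Icc,
    ENNReal.toReal_ofReal (by linarith), show 2 * r - r = r by ring, Finset.mul_sum,
    Finset.mul_sum, Finset.sum_div]
  refine Finset.sum_le_sum fun i hi => ?_
  rw [integral_indicator_one measurableSet_Icc, measureReal_restrict_apply measurableSet_Icc,
    inv_mul_eq_div]
  gcongr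
  calc volume.real (Set.Icc (c i - l i) (c i + l i) ∩ Set.Icc r (2 * r))
      ≤ volume.real (Set.Icc (c i - l i) (c i + l i)) :=
        measureReal_mono Set.inter_subset_left (by simp)
    _ = 2 * l i := by
        rw [Measure.real, Real.volume_Icc, ENNReal.toReal_ofReal (by linarith [hl i hi])]; ring

/-- Dyadic summation: a bound for the sum of
a family of weights, given the number of weights in each dyadic range. -/
theorem sum_le_of_dyadic_card {ι : Type*} (G : Finset ι) (l : ι → ℝ) {R : ℝ} (hR : 0 ≤ R)
    (M : ℕ → ℝ) (hl : ∀ i ∈ G, l i < R)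
    (hM : ∀ k : ℕ, ((G.filter fun i => R / 2 ^ (k + 1) ≤ l i ∧ l i < R / 2 ^ k).card : ℝ) ≤ M k)
    (T : ℕ) :
    ∑ i ∈ G, l i ≤ R * ∑ k ∈ Finset.range T, M k / 2 ^ k + R * G.card / 2 ^ T := by
  have key : ∀ T : ℕ, ∑ i ∈ G, l i ≤ R * ∑ k ∈ Finset.range T, M k / 2 ^ k +
      ∑ i ∈ G.filter (fun i => l i < R / 2 ^ T), l i := by
    intro T
    induction T with
    | zero =>
      rw [Finset.filter_true_of_mem (by simpa using hl)]
      simp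
    | succ T ih =>
      refine ih.trans ?_
      rw [Finset.sum_range_succ, mul_add, add_assoc]
      gcongr
      rw [← Finset.sum_filter_add_sum_filter_not (G.filter fun i => l i < R / 2 ^ T)
        (fun i => R / 2 ^ (T + 1) ≤ l i), Finset.filter_filter, Finset.filter_filter]
      have hle : R / 2 ^ (T + 1) ≤ R / 2 ^ T := by gcongr <;> norm_num
      have e1 : (G.filter fun i => l i < R / 2 ^ T ∧ ¬ R / 2 ^ (T + 1) ≤ l i) =
          G.filter fun i => l i < R / 2 ^ (T + 1) := by
        refine Finset.filter_congr fun i _ => ?_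
        rw [not_le]
        exact ⟨fun h => h.2, fun h => ⟨h.trans_le hle, h⟩⟩
      rw [e1]
      gcongr
      have e2 : (G.filter fun i => l i < R / 2 ^ T ∧ R / 2 ^ (T + 1) ≤ l i) =
          G.filter fun i => R / 2 ^ (T + 1) ≤ l i ∧ l i < R / 2 ^ T :=
        Finset.filter_congr fun i _ => and_comm
      rw [e2]
      refine (Finset.sum_le_card_nsmul _ _ (R / 2 ^ T)
        fun i hi => (Finset.mem_filter.1 hi).2.2.le).trans ?_
      rw [nsmul_eq_mul]
      calc _ ≤ M T * (R / 2 ^ T) := by gcongr; exact hM T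
        _ = _ := by ring
  refine (key T).trans ?_
  gcongr
  refine (Finset.sum_le_card_nsmul _ _ (R / 2 ^ T)
    fun i hi => (Finset.mem_filter.1 hi).2.le).trans ?_
  rw [nsmul_eq_mul, mul_comm R, mul_div_assoc]
  gcongr
  exact Finset.filter_subset _ _

/-! ### The crossing rate and the choice of the number of scales -/

/-- Lets additive constants be absorbed into a multiple of the rate, uniformly in δ. -/
theorem half_le_crossingRate {δ : ℝ} (hδ : 0 < δ) {n : ℕ} (hn : 2 ≤ n) :
    1 / 2 ≤ crossingRate δ n := by
  have hn' : (2 : ℝ) ≤ n := by exact_mod_cast hn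
  unfold crossingRate
  split_ifs with h1 h2
  · have : (1 : ℝ) ≤ (n : ℝ) ^ (1 - 1 / δ) := by
      refine Real.one_le_rpow (by linarith) ?_
      rw [sub_nonneg, div_le_one hδ]; exact h1.le
    linarith
  · have := Real.log_le_log (by norm_num) hn'
    linarith [Real.log_two_gt_d9]
  · have hlt : δ < 1 := lt_of_le_of_ne (not_lt.1 h1) h2
    have ha : (1 : ℝ) < 2 ^ (1 - δ) := Real.one_lt_rpow (by norm_num) (by linarith)
    have hb : (2 : ℝ) ^ (1 - δ) ≤ 2 ^ (1 : ℝ) :=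
      Real.rpow_le_rpow_of_exponent_le (by norm_num) (by linarith)
    rw [Real.rpow_one] at hb
    rw [div_le_div_iff₀ (by norm_num) (by linarith)]
    linarith

/-- The constant in the geometric sum for exponents larger than `1`. -/
noncomputable def supercriticalConst (δ : ℝ) : ℝ := (2 : ℝ) ^ (δ - 1) / (2 ^ (δ - 1) - 1) + 1

/-- The number of scales can be chosen so that the dyadic sum is of the order of the crossing
rate. -/
theorem exists_geom_sum_le_crossingRate {δ : ℝ} (hδ : 0 < δ) {n : ℕ} (hn : 2 ≤ n) :
    ∃ T : ℕ, ∑ k ∈ Finset.range T, ((2 : ℝ) ^ (δ - 1)) ^ k + n / 2 ^ T ≤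
      (if 1 < δ then supercriticalConst δ else 8) * crossingRate δ n := by
  have hn' : (2 : ℝ) ≤ n := by exact_mod_cast hn
  have hn0 : (0 : ℝ) < n := by linarith
  rcases lt_trichotomy δ 1 with h | h | h
  · obtain ⟨T, -, hT⟩ := exists_nat_pow_near (x := (n : ℝ)) (y := 2) (by linarith) (by norm_num)
    refine ⟨T + 1, ?_⟩
    have hr := half_le_crossingRate hδ hn
    have h2 : (n : ℝ) / 2 ^ (T + 1) ≤ 1 := by
      rw [div_le_one (by positivity)]; exact hT.le
    have ha : (1 : ℝ) < 2 ^ (1 - δ) := Real.one_lt_rpow (by norm_num) (by linarith)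
    have hq : (2 : ℝ) ^ (δ - 1) = (2 ^ (1 - δ))⁻¹ := by
      rw [← Real.rpow_neg (by norm_num)]; congr 1; ring
    have hq1 : (2 : ℝ) ^ (δ - 1) < 1 := by rw [hq]; exact inv_lt_one_of_one_lt₀ ha
    have hq0 : (0 : ℝ) < 2 ^ (δ - 1) := by positivity
    have hsum : ∑ k ∈ Finset.range (T + 1), ((2 : ℝ) ^ (δ - 1)) ^ k ≤ 1 / (1 - 2 ^ (δ - 1)) := by
      rw [geom_sum_eq hq1.ne, ← neg_div_neg_eq]
      have : 0 < ((2 : ℝ) ^ (δ - 1)) ^ (T + 1) := by positivity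
      rw [neg_sub, neg_sub]
      have h3 : (0 : ℝ) < 1 - 2 ^ (δ - 1) := by linarith
      gcongr
      linarith
    -- With a = 2^(1 - δ), the full geometric series is a / (a - 1) = 1 + 1 / (a - 1).
    have heq : 1 / (1 - (2 : ℝ) ^ (δ - 1)) = 1 + crossingRate δ n := by
      rw [crossingRate, if_neg h.not_gt, if_neg h.ne, hq]
      have : (2 : ℝ) ^ (1 - δ) - 1 ≠ 0 := by linarith
      have h5 : (2 : ℝ) ^ (1 - δ) ≠ 0 := by positivity
      field_simp
      ring
    rw [if_neg h.not_gt]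
    linarith
  · subst h
    obtain ⟨T, hT', hT⟩ := exists_nat_pow_near (x := (n : ℝ)) (y := 2) (by linarith) (by norm_num)
    refine ⟨T + 1, ?_⟩
    have hr := half_le_crossingRate hδ hn
    have h2 : (n : ℝ) / 2 ^ (T + 1) ≤ 1 := by
      rw [div_le_one (by positivity)]; exact hT.le
    have h3 : (T : ℝ) * Real.log 2 ≤ Real.log n := by
      rw [← Real.log_pow]; exact Real.log_le_log (by positivity) hT'
    rw [if_neg (lt_irrefl _)]
    rw [crossingRate, if_neg (lt_irrefl _), if_pos rfl] at hr ⊢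
    have h4 : (T : ℝ) * (1 / 2) ≤ T * Real.log 2 := by
      gcongr; linarith [Real.log_two_gt_d9]
    simp only [sub_self, Real.rpow_zero, one_pow, Finset.sum_const, Finset.card_range, nsmul_eq_mul,
      mul_one, Nat.cast_add, Nat.cast_one]
    linarith
  · have hx : (1 : ℝ) ≤ (n : ℝ) ^ (1 / δ) := Real.one_le_rpow (by linarith) (by positivity)
    -- At 2^T near n^(1/δ) the last term of the geometric sum and the remainder n / 2^T are both of
    -- order n^(1 - 1/δ).
    obtain ⟨T, hT', hT⟩ := exists_nat_pow_near hx (y := 2) (by norm_num)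
    refine ⟨T + 1, ?_⟩
    rw [if_pos h, crossingRate, if_pos h, supercriticalConst, add_mul, one_mul]
    have hq1 : (1 : ℝ) < 2 ^ (δ - 1) := Real.one_lt_rpow (by norm_num) (by linarith)
    have hn1 : (n : ℝ) / 2 ^ (T + 1) ≤ (n : ℝ) ^ (1 - 1 / δ) := by
      rw [Real.rpow_sub hn0, Real.rpow_one]
      gcongr
    have hqT : ((2 : ℝ) ^ (δ - 1)) ^ (T + 1) ≤ 2 ^ (δ - 1) * (n : ℝ) ^ (1 - 1 / δ) := by
      rw [pow_succ', ← Real.rpow_natCast, ← Real.rpow_mul (by norm_num), mul_comm (δ - 1),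
        Real.rpow_mul (by norm_num), Real.rpow_natCast]
      have : ((2 : ℝ) ^ T) ^ (δ - 1) ≤ ((n : ℝ) ^ (1 / δ)) ^ (δ - 1) :=
        Real.rpow_le_rpow (by positivity) hT' (by linarith)
      rw [← Real.rpow_mul hn0.le, show 1 / δ * (δ - 1) = 1 - 1 / δ by field_simp] at this
      gcongr
    rw [geom_sum_eq hq1.ne']
    have h3 : (0 : ℝ) < 2 ^ (δ - 1) - 1 := by linarith
    refine add_le_add ?_ hn1
    rw [div_mul_eq_mul_div]
    gcongr
    linarith

/-! ### Edges crossing a sphere of averaged radius -/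

/-- The net bound limits the number of long tour edges that start near a given point. -/
theorem NetBound.card_long_edges_le {d : ℕ} {F : Set (Finset (Euc d))} {δ K : ℝ}
    (hF : NetBound F δ K) {P : Finset (Euc d)} (hP : P ∈ F) {e : Tour P} (he : IsOptimalTour e)
    (o : Euc d) {r : ℝ} (hr : 0 < r) (hδd : δ ≤ d) (k : ℕ) (J : Finset (Fin P.card))
    (hlow : ∀ i ∈ J, 16 * r / 2 ^ k ≤ dist (e i : Euc d) (e (finRotate P.card i)))
    (hnear : ∀ i ∈ J, dist (e i : Euc d) o ≤ 34 * r) :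
    (J.card : ℝ) ≤ 2 * 5 ^ d * |K| * 35 ^ d * ((2 : ℝ) ^ k) ^ δ := by
  classical
  have h2k : (1 : ℝ) ≤ 2 ^ k := one_le_pow₀ (by norm_num)
  set ε := r / 2 ^ k with hε
  have hε0 : 0 < ε := by positivity
  have hεr : ε ≤ r := div_le_self hr.le h2k
  obtain ⟨N, hN⟩ := exists_isEpsNet P hε0
  have hcount := hF P hP ε (35 * r) hε0 (by linarith) N hN o
  have hset : (N : Set (Euc d)) ∩ Metric.closedBall o (35 * r) =
      ((N.filter fun y => dist y o ≤ 35 * r : Finset (Euc d)) : Set (Euc d)) := by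
    ext; simp
  rw [hset, Set.ncard_coe_finset] at hcount
  have hmaps : ∀ i : Fin P.card, ∃ y : Euc d, y ∈ N ∧ dist (e i : Euc d) y ≤ ε :=
    fun i => hN.2.1 _ (e i).2
  choose y hyN hy using hmaps
  -- Edges of length at least 16 * ε charged to one net point start within 2 * ε < 16 * ε / 4 of
  -- each other, so packing bounds each fibre.
  have hcard : J.card ≤ (2 * 5 ^ d) * (N.filter fun y => dist y o ≤ 35 * r).card := by
    refine Finset.card_le_mul_card_image_of_maps_to (f := y) ?_ _ ?_
    · intro i hi
      refine Finset.mem_filter.2 ⟨hyN i, ?_⟩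
      have := dist_triangle_left (y i) o (e i : Euc d)
      linarith [hnear i hi, hy i]
    · intro z _
      refine he.card_le_of_close (L := 16 * r / 2 ^ k) (by positivity) _ (fun i => (e i : Euc d))
        (fun i hi => hlow i (Finset.mem_filter.1 hi).1)
        (fun i _ => left_mem_segment _ _ _) ?_
      intro i hi j hj
      have h1 := hy i
      have h2 := hy j
      rw [(Finset.mem_filter.1 hi).2] at h1
      rw [(Finset.mem_filter.1 hj).2] at h2
      have := dist_triangle_right (e i : Euc d) (e j) z
      rw [mul_div_assoc, ← hε]
      linarith
  have hcard' : (J.card : ℝ) ≤ (2 * 5 ^ d) * ((N.filter fun y => dist y o ≤ 35 * r).card : ℝ) := by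
    exact_mod_cast hcard
  refine hcard'.trans ?_
  have hratio : 35 * r / ε = 35 * 2 ^ k := by
    rw [hε]; field_simp
  rw [hratio, Real.mul_rpow (by norm_num) (by positivity)] at hcount
  -- Keeps the constant free of δ, as the uniform statement for δ ≤ 1 needs.
  have h35 : (35 : ℝ) ^ δ ≤ 35 ^ d := by
    rw [← Real.rpow_natCast]
    exact Real.rpow_le_rpow_of_exponent_le (by norm_num) hδd
  calc _ ≤ 2 * 5 ^ d * (|K| * (35 ^ d * ((2 : ℝ) ^ k) ^ δ)) := by
        gcongr
        refine hcount.trans ?_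
        gcongr
        exact le_abs_self K
    _ = _ := by ring

/-- The coefficient of the dyadic sum in the bound for the number of crossing edges. -/
noncomputable def levelConst (d : ℕ) (K : ℝ) : ℝ := 2 * 5 ^ d * |K| * 35 ^ d

theorem levelConst_nonneg (d : ℕ) (K : ℝ) : 0 ≤ levelConst d K := by
  unfold levelConst; positivity

/-- Some sphere with radius in `[r, 2 * r]` about a given point crosses few edges of an optimal
tour. -/
theorem NetBound.exists_radius_card_crossing_le {d : ℕ} {F : Set (Finset (Euc d))} {δ K : ℝ}
    (hF : NetBound F δ K) {P : Finset (Euc d)} (hP : P ∈ F) {e : Tour P} (he : IsOptimalTour e)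
    (o : Euc d) {r : ℝ} (hr : 0 < r) (hδd : δ ≤ d) (T : ℕ) :
    ∃ ρ ∈ Set.Icc r (2 * r),
      (({w ∈ tourEdges e | (w ∩ Metric.sphere o ρ).Nonempty}).ncard : ℝ) ≤
        2 * 5 ^ d + 64 * (levelConst d K + 1) *
          (∑ k ∈ Finset.range T, ((2 : ℝ) ^ (δ - 1)) ^ k + P.card / 2 ^ T) := by
  classical
  set l : Fin P.card → ℝ := fun i => dist (e i : Euc d) (e (finRotate P.card i)) with hl
  -- An edge shorter than 32 * r meeting the ball of radius 2 * r starts within 34 * r of `o`.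
  -- Longer edges meeting that ball have points there at mutual distance at most 4 * r < 32 * r / 4.
  set G : Finset (Fin P.card) :=
    Finset.univ.filter fun i => l i < 32 * r ∧ dist (e i : Euc d) o ≤ 34 * r with hG
  set H : Finset (Fin P.card) := Finset.univ.filter fun i => 32 * r ≤ l i ∧
    ∃ x ∈ segment ℝ (e i : Euc d) (e (finRotate P.card i)), dist x o ≤ 2 * r with hH
  obtain ⟨ρ, hρ, hcross⟩ := exists_card_filter_abs_sub_le G (fun i => dist (e i : Euc d) o) l
    (fun i _ => dist_nonneg) hr
  refine ⟨ρ, hρ, ?_⟩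
  have hHcard : H.card ≤ 2 * 5 ^ d := by
    have hp : ∀ i, ∃ x : Euc d, i ∈ H →
        x ∈ segment ℝ (e i : Euc d) (e (finRotate P.card i)) ∧ dist x o ≤ 2 * r := by
      intro i
      by_cases hi : i ∈ H
      · obtain ⟨x, hx⟩ := (Finset.mem_filter.1 hi).2.2
        exact ⟨x, fun _ => hx⟩
      · exact ⟨0, fun h => absurd h hi⟩
    choose p hp using hp
    refine he.card_le_of_close (L := 32 * r) (by positivity) H p
      (fun i hi => (Finset.mem_filter.1 hi).2.1) (fun i hi => (hp i hi).1) ?_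
    intro i hi j hj
    have := dist_triangle_right (p i) (p j) o
    linarith [(hp i hi).2, (hp j hj).2]
  have hsum : ∑ i ∈ G, l i ≤ 32 * r * ∑ k ∈ Finset.range T,
      (levelConst d K * ((2 : ℝ) ^ k) ^ δ) / 2 ^ k + 32 * r * G.card / 2 ^ T := by
    refine sum_le_of_dyadic_card G l (R := 32 * r) (by positivity) _
      (fun i hi => (Finset.mem_filter.1 hi).2.1) ?_ T
    intro k
    refine hF.card_long_edges_le hP he o hr hδd k _ ?_ ?_
    · intro i hi
      have := (Finset.mem_filter.1 hi).2.1
      rw [pow_succ] at this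
      calc 16 * r / 2 ^ k = 32 * r / (2 ^ k * 2) := by field_simp; norm_num
        _ ≤ _ := this
    · intro i hi
      exact (Finset.mem_filter.1 (Finset.mem_filter.1 hi).1).2.2
  have hq : ∀ k : ℕ, (levelConst d K * ((2 : ℝ) ^ k) ^ δ) / 2 ^ k =
      levelConst d K * ((2 : ℝ) ^ (δ - 1)) ^ k := by
    intro k
    rw [Real.rpow_sub (by norm_num), Real.rpow_one, div_pow, mul_div_assoc]
    congr 2
    rw [← Real.rpow_natCast, ← Real.rpow_natCast, ← Real.rpow_mul (by norm_num),
      ← Real.rpow_mul (by norm_num), mul_comm]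
  simp only [hq, ← Finset.mul_sum] at hsum
  have hGcard : (G.card : ℝ) ≤ P.card := by
    have := Finset.card_le_univ G
    rw [Fintype.card_fin] at this
    exact_mod_cast this
  have hsub : {w ∈ tourEdges e | (w ∩ Metric.sphere o ρ).Nonempty} ⊆
      (((H ∪ G.filter fun i => |ρ - dist (e i : Euc d) o| ≤ l i).image
        fun i => segment ℝ (e i : Euc d) (e (finRotate P.card i)) : Finset (Set (Euc d))) :
        Set (Set (Euc d))) := by
    rintro w ⟨⟨i, rfl⟩, x, hx, hxo⟩
    rw [Metric.mem_sphere] at hxo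
    refine Finset.mem_coe.2 (Finset.mem_image.2 ⟨i, ?_, rfl⟩)
    have hxa : dist x (e i : Euc d) ≤ l i := by
      rw [hl]
      have := (convex_closedBall (e i : Euc d) (l i)).segment_subset
        (Metric.mem_closedBall_self dist_nonneg)
        (by rw [Metric.mem_closedBall, dist_comm] : (e (finRotate P.card i) : Euc d) ∈ _) hx
      exact Metric.mem_closedBall.1 this
    rw [Finset.mem_union]
    rcases le_or_gt (32 * r) (l i) with h | h
    · exact Or.inl (Finset.mem_filter.2 ⟨Finset.mem_univ _, h, x, hx, hxo ▸ hρ.2⟩)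
    · refine Or.inr (Finset.mem_filter.2 ⟨Finset.mem_filter.2 ⟨Finset.mem_univ _, h, ?_⟩, ?_⟩)
      · have := dist_triangle_left (e i : Euc d) o x
        linarith [hρ.2]
      · rw [← hxo]
        exact (abs_dist_sub_le x (e i : Euc d) o).trans hxa
  have hcard : ({w ∈ tourEdges e | (w ∩ Metric.sphere o ρ).Nonempty}).ncard ≤
      H.card + (G.filter fun i => |ρ - dist (e i : Euc d) o| ≤ l i).card := by
    refine (Set.ncard_le_ncard hsub (Finset.finite_toSet _)).trans ?_
    rw [Set.ncard_coe_finset]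
    exact Finset.card_image_le.trans (Finset.card_union_le _ _)
  have hcard' : (({w ∈ tourEdges e | (w ∩ Metric.sphere o ρ).Nonempty}).ncard : ℝ) ≤
      2 * 5 ^ d + ((G.filter fun i => |ρ - dist (e i : Euc d) o| ≤ l i).card : ℝ) := by
    have h1 : (({w ∈ tourEdges e | (w ∩ Metric.sphere o ρ).Nonempty}).ncard : ℝ) ≤
      (H.card : ℝ) + ((G.filter fun i => |ρ - dist (e i : Euc d) o| ≤ l i).card : ℝ) := by
      exact_mod_cast hcard
    have h2 : (H.card : ℝ) ≤ 2 * 5 ^ d := by exact_mod_cast hHcard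
    linarith
  refine hcard'.trans (add_le_add le_rfl (hcross.trans ?_))
  set S := ∑ k ∈ Finset.range T, ((2 : ℝ) ^ (δ - 1)) ^ k with hS
  have hS0 : 0 ≤ S := Finset.sum_nonneg fun k _ => by positivity
  have hD := levelConst_nonneg d K
  have hfrac : (0 : ℝ) ≤ (P.card : ℝ) / 2 ^ T := by positivity
  calc 2 * (∑ i ∈ G, l i) / r
      ≤ 2 * (32 * r * (levelConst d K * S) + 32 * r * P.card / 2 ^ T) / r := by
        gcongr
        refine hsum.trans ?_
        gcongr
    _ = 64 * (levelConst d K * S + P.card / 2 ^ T) := by field_simp; ring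
    _ ≤ 64 * (levelConst d K + 1) * (S + P.card / 2 ^ T) := by
        nlinarith [mul_nonneg hD hfrac]

/-! ### Balance from a minimal dense ball -/

/-- There is a smallest closed ball that is centred in `P` and contains `m` points of `P`. -/
theorem exists_minimal_ball {X : Type*} [MetricSpace X] (P : Finset X) {m : ℕ} (hm : 2 ≤ m)
    (hmP : m ≤ P.card) :
    ∃ (o : X) (r : ℝ), 0 < r ∧ m ≤ (P.filter fun x => dist x o ≤ r).card ∧
      ∀ p ∈ P, (P.filter fun x => dist x p < r).card < m := by
  classical
  set D : Finset ℝ := ((P ×ˢ P).image fun z => dist z.1 z.2).filter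
    fun ρ => ∃ p ∈ P, m ≤ (P.filter fun x => dist x p ≤ ρ).card with hD
  -- Shrinking a ball to its farthest point of `Q` makes the radius an attained distance. If `Q`
  -- lies in an open ball, that radius is strictly smaller, contradicting minimality.
  have hattain : ∀ p ∈ P, ∀ Q ⊆ P, m ≤ Q.card →
      ∃ y ∈ Q, dist y p ∈ D := by
    intro p hp Q hQ hc
    obtain ⟨y, hy, hmax⟩ := Q.exists_max_image (fun x => dist x p)
      (Finset.card_pos.1 (by omega))
    refine ⟨y, hy, Finset.mem_filter.2 ⟨Finset.mem_image.2
      ⟨(y, p), Finset.mk_mem_product (hQ hy) hp, rfl⟩, p, hp, hc.trans (Finset.card_le_card ?_)⟩⟩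
    exact fun x hx => Finset.mem_filter.2 ⟨hQ hx, hmax x hx⟩
  obtain ⟨p₀, hp₀⟩ : P.Nonempty := Finset.card_pos.1 (by omega)
  obtain ⟨y₀, -, hy₀⟩ := hattain p₀ hp₀ P subset_rfl hmP
  have hne : D.Nonempty := ⟨_, hy₀⟩
  obtain ⟨-, o, ho, hcard⟩ := Finset.mem_filter.1 (D.min'_mem hne)
  refine ⟨o, D.min' hne, ?_, hcard, ?_⟩
  · by_contra! hle
    have : (P.filter fun x => dist x o ≤ D.min' hne) ⊆ {o} := by
      intro x hx
      exact Finset.mem_singleton.2 (dist_le_zero.1 ((Finset.mem_filter.1 hx).2.trans hle))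
    have := Finset.card_le_card this
    rw [Finset.card_singleton] at this
    omega
  · intro p hp
    by_contra! hle
    obtain ⟨y, hy, hyD⟩ := hattain p hp _ (Finset.filter_subset _ _) hle
    exact absurd (D.min'_le _ hyD) (not_le.2 (Finset.mem_filter.1 hy).2)

/-- If open balls of radius `r` have at most `k` points of `P`, then closed balls of radius `2 * r`
have at most `5 ^ d * k` points of `P`. -/
theorem card_filter_dist_le_two_mul {d : ℕ} (P : Finset (Euc d)) (o : Euc d) {r : ℝ} (hr : 0 < r)
    {k : ℕ} (hk : ∀ p ∈ P, (P.filter fun x => dist x p < r).card ≤ k) :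
    (P.filter fun x => dist x o ≤ 2 * r).card ≤ 5 ^ d * k := by
  classical
  obtain ⟨N, hNQ, hcov, hsep⟩ := exists_maximal_separated (P.filter fun x => dist x o ≤ 2 * r) hr
  have hN : N.card ≤ 5 ^ d := by
    have hinj : Function.Injective fun x : Euc d => r⁻¹ • (x - o) :=
      (smul_right_injective _ (inv_pos.2 hr).ne').comp sub_left_injective
    rw [← Finset.card_image_of_injective N hinj]
    have := Besicovitch.card_le_of_separated (N.image fun x : Euc d => r⁻¹ • (x - o))
      (by
        intro c hc
        obtain ⟨x, hx, rfl⟩ := Finset.mem_image.1 hc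
        have := (Finset.mem_filter.1 (hNQ hx)).2
        rw [norm_smul, norm_inv, Real.norm_of_nonneg hr.le, ← dist_eq_norm, inv_mul_le_iff₀ hr]
        linarith)
      (by
        intro c hc c' hc' hne
        obtain ⟨x, hx, rfl⟩ := Finset.mem_image.1 hc
        obtain ⟨y, hy, rfl⟩ := Finset.mem_image.1 hc'
        have := hsep x hx y hy (fun h => hne (h ▸ rfl))
        rw [← smul_sub, sub_sub_sub_cancel_right, norm_smul, norm_inv, Real.norm_of_nonneg hr.le,
          ← dist_eq_norm, le_inv_mul_iff₀ hr]
        linarith)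
    rwa [finrank_euclideanSpace, Fintype.card_fin] at this
  have hsub : (P.filter fun x => dist x o ≤ 2 * r) ⊆
      N.biUnion fun y => P.filter fun x => dist x y < r := by
    intro x hx
    obtain ⟨y, hy, hxy⟩ := hcov x hx
    exact Finset.mem_biUnion.2 ⟨y, hy, Finset.mem_filter.2 ⟨(Finset.mem_filter.1 hx).1, hxy⟩⟩
  calc _ ≤ _ := Finset.card_le_card hsub
    _ ≤ N.card * k := Finset.card_biUnion_le_card_mul _ _ _ fun y hy =>
        hk y (Finset.mem_filter.1 (hNQ hy)).1
    _ ≤ 5 ^ d * k := by gcongr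

/-- The source of c = 4: 2 * 5^d ≤ 10^d ≤ 16^d. -/
theorem two_rpow_neg_four_mul_le {d : ℕ} (hd : 1 ≤ d) :
    (2 : ℝ) ^ (-(4 * (d : ℝ))) ≤ 1 / (2 * 5 ^ d) := by
  have h16 : (2 : ℝ) ^ (-(4 * (d : ℝ))) = 1 / 16 ^ d := by
    rw [Real.rpow_neg (by norm_num), Real.rpow_mul (by norm_num), one_div]
    norm_num [Real.rpow_natCast]
  rw [h16]
  refine one_div_le_one_div_of_le (by positivity) ?_
  calc (2 : ℝ) * 5 ^ d ≤ 2 ^ d * 5 ^ d := by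
        gcongr
        exact le_self_pow₀ (by norm_num) (by omega)
    _ = 10 ^ d := by rw [← mul_pow]; norm_num
    _ ≤ 16 ^ d := by gcongr; norm_num

/-- For tours of at most `2 * 5 ^ d` points, a sphere through a point is a separator. -/
theorem hasSphereSeparator_of_card_le {d : ℕ} (hd : 1 ≤ d) {P : Finset (Euc d)} (hP2 : 2 ≤ P.card)
    (hP : P.card ≤ 2 * 5 ^ d) (e : Tour P) {M : ℝ} (hM : (P.card : ℝ) ≤ M) :
    HasSphereSeparator 4 P (tourEdges e) M := by
  classical
  -- Here n * 2^(-4 * d) ≤ 1, so each side need omit only one point. The sphere about `p` through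
  -- `q` has `q` on neither side.
  obtain ⟨p, hp, q, hq, hpq⟩ := Finset.one_lt_card.1 (show 1 < P.card by omega)
  have hle : ∀ s : Set (Euc d), s ⊆ (P.erase q : Finset (Euc d)) →
      ((s.ncard : ℕ) : ℝ) ≤ (1 - (2 : ℝ) ^ (-(4 * (d : ℝ)))) * (P.card : ℝ) := by
    intro s hs
    have h1 := Set.ncard_le_ncard hs (Finset.finite_toSet _)
    rw [Set.ncard_coe_finset, Finset.card_erase_of_mem hq] at h1
    have h2 : (s.ncard : ℝ) ≤ P.card - 1 := by
      rw [le_sub_iff_add_le]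
      have : s.ncard + 1 ≤ P.card := by omega
      exact_mod_cast this
    have h3 : (P.card : ℝ) ≤ 2 * 5 ^ d := by exact_mod_cast hP
    have h4 : (2 : ℝ) ^ (-(4 * (d : ℝ))) * P.card ≤ 1 / (2 * 5 ^ d) * (2 * 5 ^ d) := by
      gcongr
      exact two_rpow_neg_four_mul_le hd
    rw [one_div_mul_cancel (by positivity)] at h4
    linarith
  refine ⟨p, dist q p, dist_pos.2 hpq.symm, hle _ ?_, hle _ ?_, le_trans ?_ hM⟩
  · rintro x ⟨hx, hxp⟩
    refine Finset.mem_coe.2 (Finset.mem_erase.2 ⟨?_, hx⟩)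
    rintro rfl
    exact lt_irrefl _ (Metric.mem_ball.1 hxp)
  · rintro x ⟨hx, hxp⟩
    refine Finset.mem_coe.2 (Finset.mem_erase.2 ⟨?_, hx⟩)
    rintro rfl
    exact hxp (Metric.mem_closedBall.2 le_rfl)
  · have h1 : (tourEdges e).ncard ≤ P.card := by
      rw [tourEdges, ← Set.image_univ]
      refine (Set.ncard_image_le Set.finite_univ).trans ?_
      rw [Set.ncard_univ, Nat.card_eq_fintype_card, Fintype.card_fin]
    have h2 := (Set.ncard_le_ncard (Set.sep_subset (tourEdges e)
      fun w => (w ∩ Metric.sphere p (dist q p)).Nonempty) (Set.finite_range _)).trans h1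
    exact_mod_cast h2

/-- The sphere separator of an optimal tour of a set that obeys a net bound. -/
theorem NetBound.hasSphereSeparator {d : ℕ} (hd : 1 ≤ d) {F : Set (Finset (Euc d))} {δ K : ℝ}
    (hδ : 0 < δ) (hδd : δ ≤ d) (hF : NetBound F δ K) {P : Finset (Euc d)} (hP : P ∈ F)
    (hP2 : 2 ≤ P.card) {e : Tour P} (he : IsOptimalTour e) :
    HasSphereSeparator 4 P (tourEdges e)
      ((4 * 5 ^ d + 64 * (levelConst d K + 1) * (if 1 < δ then supercriticalConst δ else 8)) *
        crossingRate δ P.card) := by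
  classical
  have hrate := half_le_crossingRate hδ hP2
  have hD := levelConst_nonneg d K
  obtain ⟨T, hT⟩ := exists_geom_sum_le_crossingRate hδ hP2
  have hM : 2 * 5 ^ d + 64 * (levelConst d K + 1) *
      (∑ k ∈ Finset.range T, ((2 : ℝ) ^ (δ - 1)) ^ k + P.card / 2 ^ T) ≤
      (4 * 5 ^ d + 64 * (levelConst d K + 1) * (if 1 < δ then supercriticalConst δ else 8)) *
        crossingRate δ P.card := by
    rw [add_mul, mul_assoc (64 * (levelConst d K + 1))]
    refine add_le_add ?_ (by gcongr)
    have : (0 : ℝ) < 5 ^ d := by positivity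
    nlinarith
  rcases le_or_gt P.card (2 * 5 ^ d) with hsmall | hlarge
  · refine hasSphereSeparator_of_card_le hd hP2 hsmall e (le_trans ?_ hM)
    have h1 : (P.card : ℝ) ≤ 2 * 5 ^ d := by exact_mod_cast hsmall
    have h2 : 0 ≤ ∑ k ∈ Finset.range T, ((2 : ℝ) ^ (δ - 1)) ^ k :=
      Finset.sum_nonneg fun k _ => by positivity
    have h3 : 0 ≤ 64 * (levelConst d K + 1) *
      (∑ k ∈ Finset.range T, ((2 : ℝ) ^ (δ - 1)) ^ k + P.card / 2 ^ T) := by positivity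
    linarith
  -- Rounding down serves both sides: at most 5^d * k ≤ n / 2 points are inside, and at least k + 1
  -- > n / (2 * 5^d) are not outside.
  set k := P.card / (2 * 5 ^ d) with hk
  have h5 : 0 < 2 * 5 ^ d := by positivity
  have hk1 : 1 ≤ k := (Nat.one_le_div_iff h5).2 hlarge.le
  have hkP : k * (2 * 5 ^ d) ≤ P.card := Nat.div_mul_le_self _ _
  have hPk : P.card < (k + 1) * (2 * 5 ^ d) := by
    have := Nat.lt_mul_div_succ P.card h5
    rwa [mul_comm] at this
  have h51 : 1 ≤ 5 ^ d := Nat.one_le_pow _ _ (by norm_num)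
  obtain ⟨o, r, hr, hin, hopen⟩ := exists_minimal_ball P (m := k + 1) (by omega) (by nlinarith)
  have hdouble := card_filter_dist_le_two_mul P o hr (k := k)
    (fun p hp => Nat.lt_succ_iff.1 (hopen p hp))
  obtain ⟨ρ, hρ, hcross⟩ := hF.exists_radius_card_crossing_le hP he o hr hδd T
  have hc := two_rpow_neg_four_mul_le hd
  have hn0 : (0 : ℝ) ≤ P.card := Nat.cast_nonneg _
  have h5r : (1 : ℝ) ≤ 5 ^ d := by exact_mod_cast h51
  refine ⟨o, ρ, hr.trans_le hρ.1, ?_, ?_, hcross.trans hM⟩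
  · have hsub : (P : Set (Euc d)) ∩ Metric.ball o ρ ⊆
        (P.filter fun x => dist x o ≤ 2 * r : Finset (Euc d)) := by
      rintro x ⟨hx, hxo⟩
      exact Finset.mem_coe.2 (Finset.mem_filter.2 ⟨hx, (Metric.mem_ball.1 hxo).le.trans hρ.2⟩)
    have h1 := Set.ncard_le_ncard hsub (Finset.finite_toSet _)
    rw [Set.ncard_coe_finset] at h1
    have h2 : 2 * ((P : Set (Euc d)) ∩ Metric.ball o ρ).ncard ≤ P.card := by nlinarith
    have h3 : 2 * (((P : Set (Euc d)) ∩ Metric.ball o ρ).ncard : ℝ) ≤ P.card := by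
      exact_mod_cast h2
    have h4 : (2 : ℝ) ^ (-(4 * (d : ℝ))) ≤ 1 / 2 := by
      refine hc.trans (one_div_le_one_div_of_le (by norm_num) ?_)
      linarith
    nlinarith
  · have hsub : (P : Set (Euc d)) \ Metric.closedBall o ρ ⊆
        (P \ P.filter fun x => dist x o ≤ r : Finset (Euc d)) := by
      rintro x ⟨hx, hxo⟩
      refine Finset.mem_coe.2 (Finset.mem_sdiff.2 ⟨hx, fun h => hxo ?_⟩)
      exact Metric.mem_closedBall.2 ((Finset.mem_filter.1 h).2.trans hρ.1)
    have h1 := Set.ncard_le_ncard hsub (Finset.finite_toSet _)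
    rw [Set.ncard_coe_finset, Finset.card_sdiff_of_subset (Finset.filter_subset _ _)] at h1
    have hle : (P.filter fun x => dist x o ≤ r).card ≤ P.card :=
      Finset.card_le_card (Finset.filter_subset _ _)
    have h2 : ((P : Set (Euc d)) \ Metric.closedBall o ρ).ncard + (k + 1) ≤ P.card := by omega
    have h3 : (((P : Set (Euc d)) \ Metric.closedBall o ρ).ncard : ℝ) + (k + 1) ≤ P.card := by
      exact_mod_cast h2
    have h4 : (P.card : ℝ) ≤ (k + 1) * (2 * 5 ^ d) := by exact_mod_cast hPk.le
    have h6 : (2 : ℝ) ^ (-(4 * (d : ℝ))) * P.card ≤ 1 / (2 * 5 ^ d) * ((k + 1) * (2 * 5 ^ d)) := by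
      gcongr
    rw [show 1 / (2 * 5 ^ d) * (((k : ℝ) + 1) * (2 * 5 ^ d)) = k + 1 by field_simp] at h6
    linarith

/-! ### The theorem and its uniform version -/

/-- The constant `c` is absolute. First part: for a family of fractal dimension `δ`, whose
defining bound holds at the exponent `δ` itself if `δ ≥ 1`. Second part: how the hidden constant
depends on the data (on `d`, on the constant `K` of the net bound, and on `δ` only if `δ > 1`). -/
theorem theorem4 :
    ∃ c : ℝ, 0 < c ∧ ∀ d : ℕ, 2 ≤ d →
      (∀ (δ : ℝ), 0 < δ → δ ≤ d → ∀ F : Set (Finset (Euc d)),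
        fractalDim F = δ → (1 ≤ δ → δ ∈ fractalExponents F) →
        ∃ C : ℝ, ∀ P ∈ F, 2 ≤ P.card → ∀ e : Tour P, IsOptimalTour e →
          HasSphereSeparator c P (tourEdges e) (C * crossingRate δ P.card)) ∧
      (∀ K : ℝ, ∃ (A : ℝ) (B : ℝ → ℝ), ∀ (δ : ℝ), 0 < δ → δ ≤ d →
        ∀ F : Set (Finset (Euc d)), NetBound F δ K →
        ∀ P ∈ F, 2 ≤ P.card → ∀ e : Tour P, IsOptimalTour e →
          HasSphereSeparator c P (tourEdges e)
            ((if 1 < δ then B δ else A) * crossingRate δ P.card)) := by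
  refine ⟨4, by norm_num, fun d hd => ⟨?_, fun K => ?_⟩⟩
  · intro δ hδ hδd F hdim hatt
    by_cases h1 : 1 ≤ δ
    · obtain ⟨-, K, hK⟩ := hatt h1
      exact ⟨_, fun P hP hP2 e he => hK.hasSphereSeparator (by omega) hδ hδd hP hP2 he⟩
    · rw [not_le] at h1
      have hne : (fractalExponents F).Nonempty := by
        -- The infimum of the empty set is 0 by convention, which δ > 0 excludes.
        by_contra hemp
        rw [fractalDim, Set.not_nonempty_iff_eq_empty.1 hemp, Real.sInf_empty] at hdim
        exact hδ.ne hdim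
      have hbdd : BddBelow (fractalExponents F) := ⟨0, fun _ h => h.1⟩
      -- Below 1 the infimum need not be attained. An admissible δ' < 1 suffices: both rates are
      -- independent of n, so their ratio goes into the hidden constant.
      obtain ⟨δ', hmem, hδ'1⟩ := exists_lt_of_csInf_lt hne (hdim.trans_lt h1)
      have hδδ' : δ ≤ δ' := hdim ▸ csInf_le hbdd hmem
      obtain ⟨-, K, hK⟩ := hmem
      have hd1 : (1 : ℝ) ≤ d := by exact_mod_cast (by omega : 1 ≤ d)
      refine ⟨(4 * 5 ^ d + 64 * (levelConst d K + 1) *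
        (if 1 < δ' then supercriticalConst δ' else 8)) * (1 / ((2 : ℝ) ^ (1 - δ') - 1)) /
        (1 / ((2 : ℝ) ^ (1 - δ) - 1)), fun P hP hP2 e he => ?_⟩
      have key := hK.hasSphereSeparator (by omega) (hδ.trans_le hδδ') (hδ'1.le.trans hd1) hP hP2 he
      have hrate := half_le_crossingRate hδ hP2
      have e1 : crossingRate δ P.card = 1 / ((2 : ℝ) ^ (1 - δ) - 1) := by
        rw [crossingRate, if_neg h1.not_gt, if_neg h1.ne]
      have e2 : crossingRate δ' P.card = 1 / ((2 : ℝ) ^ (1 - δ') - 1) := by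
        rw [crossingRate, if_neg hδ'1.not_gt, if_neg hδ'1.ne]
      rw [← e1, ← e2, div_mul_cancel₀ _ (by linarith)]
      exact key
  · refine ⟨4 * 5 ^ d + 64 * (levelConst d K + 1) * 8,
      fun δ => 4 * 5 ^ d + 64 * (levelConst d K + 1) * supercriticalConst δ, ?_⟩
    intro δ hδ hδd F hF P hP hP2 e he
    have key := hF.hasSphereSeparator (by omega) hδ hδd hP hP2 he
    split_ifs at key ⊢ <;> exact key
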